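/- Setting. Let $\Omega\subset\mathbb R^3$ be an open cuboid and let $\Gamma\subset\Omega$ be a closed (compact, without boundary) embedded $C^2$ surface that separates $\Omega$ into two open sets $\Omega^-$ and $\Omega^+$: they are disjoint, $\Omega^-\cup\Omega^+=\Omega\setminus\Gamma$, and every point of $\Gamma$ is a limit of points of each. Let $\beta^-,\beta^+>0$ and $\beta=\beta^\pm$ on $\Omega^\pm$; by the $\pm$ side of $\Gamma$ we mean $\overline{\Omega^\pm}\setminus\Gamma$. Let $\mathcal T_h$ be a Cartesian (tensor-product) mesh of $\Omega$ by closed cuboids, with $h$ the largest edge length, such that - (H1) $h<r_\Gamma/(3\sqrt3)$, where the reach $r_\Gamma$ is the supremum of all $r$ for which the segments of length $2r$ centred at, and perpendicular to $\Gamma$ at, distinct points of $\Gamma$ are disjoint; - (H2) $h\kappa\le 0.0288$, where $\kappa$ is the maximal absolute principal curvature of $\Gamma$; - (H3) $\Gamma$ meets no edge of the mesh at more than one point; - (H4) $\Gamma$ meets no face of the mesh at more than two of its edges. An element $T\in\mathcal T_h$ is an interface element if its vertices are not all on the same side of $\Gamma$; write $T^\pm$ for the part of $T$ on the $\pm$ side.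 For such a $T$ let $D_1,D_2,D_3$ be any three non-collinear points at which $\Gamma$ meets edges of $T$, let $\tau_T$ be the plane through them, $\bar{\mathbf n}$ a unit normal of $\tau_T$ and $X_T$ the centroid of the triangle $D_1D_2D_3$. A trilinear IFE function $\phi_T$ on $T$ is given by $\phi_T=\phi^\pm$ on $T^\pm$, where $\phi^-,\phi^+\in\mathrm{Span}\{1,x,y,z,xy,yz,xz,xyz\}$ agree on $\tau_T$, have the same coefficients of $xy,yz,xz,xyz$, and satisfy $\beta^-\nabla\phi^-(X_T)\cdot\bar{\mathbf n}=\beta^+\nabla\phi^+(X_T)\cdot\bar{\mathbf n}$. The gradient $\nabla\phi_T$ is taken piecewise, $L^2$ norms over $T$ are over $T^-\cup T^+$, and $L^2$ norms over a face $F$ of $T$ are over $F\cap(T^-\cup T^+)$; $\mathbf n$ is the unit normal of $F$. Theorem (Trace inequalities). For every $\sigma>0$ there is a constant $C>0$, depending only on $\sigma$ (and not on $\Omega$, $\Gamma$, the mesh, $h$, the way the interface cuts $T$, the choice of $D_1,D_2,D_3$, or $\beta^\pm$), such that in every setting as above, for every interface element $T$ all of whose edges have length at least $h/\sigma$, at least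 one of the following two statements holds: 1. for every face $F$ of $T$ and every trilinear IFE function $\phi_T$ on $T$, $$\|\nabla\phi_T\cdot\mathbf n\|_{L^2(F)}\le C h^{-1/2}\|\nabla\phi_T\|_{L^2(T)};$$ 2. for every face $F$ of $T$ and every trilinear IFE function $\phi_T$ on $T$, $$\|\beta\nabla\phi_T\cdot\mathbf n\|_{L^2(F)}\le C h^{-1/2}\|\beta\nabla\phi_T\|_{L^2(T)}.$$ If moreover $\beta^-\le\beta^+$, then for every face $F$ of $T$ and every trilinear IFE function $\phi_T$ on $T$, $$\|\beta\nabla\phi_T\cdot\mathbf n\|_{L^2(F)}\le C h^{-1/2}\,\frac{\beta^+}{\sqrt{\beta^-}}\,\|\sqrt\beta\,\nabla\phi_T\|_{L^2(T)}.$$ -/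

import Mathlib

open scoped ENNReal NNReal Topology

/-- Euclidean three-space. -/
abbrev E3 : Type := EuclideanSpace ℝ (Fin 3)

/-! ### Cartesian cuboidal meshes -/

/-- A Cartesian cuboidal mesh of an open cuboid in `ℝ³`: along each axis `i` a strictly increasing
list of `N i + 1` grid coordinates with `N i ≥ 1`; the first and the last one bound the cuboid. -/
structure CartesianMesh where
  N : Fin 3 → ℕ
  N_pos : ∀ i, 0 < N i
  node : (i : Fin 3) → Fin (N i + 1) → ℝ
  node_strictMono : ∀ i, StrictMono (node i)

namespace CartesianMesh

/-- The open cuboid `Ω` that is meshed. -/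
def domain (M : CartesianMesh) : Set E3 :=
  {x | ∀ i, M.node i 0 < x i ∧ x i < M.node i (Fin.last (M.N i))}

/-- The elements of the mesh are indexed by one grid interval along each axis. -/
abbrev Cell (M : CartesianMesh) : Type := (i : Fin 3) → Fin (M.N i)

/-- The lower (`b = false`) and the upper (`b = true`) end of the `i`-th grid interval of a cell. -/
def bound (M : CartesianMesh) (T : M.Cell) (i : Fin 3) (b : Bool) : ℝ :=
  if b then M.node i (T i).succ else M.node i (T i).castSucc

/-- The length of the edges of a cell that are parallel to the `i`-th axis. -/
def edgeLength (M : CartesianMesh) (T : M.Cell) (i : Fin 3) : ℝ :=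
  M.bound T i true - M.bound T i false

/-- The mesh size `h`: the maximum of all edge lengths. -/
noncomputable def h (M : CartesianMesh) : ℝ :=
  ⨆ q : M.Cell × Fin 3, M.edgeLength q.1 q.2

/-- The (closed) cuboid of a cell. -/
def cuboid (M : CartesianMesh) (T : M.Cell) : Set E3 :=
  {x | ∀ i, M.bound T i false ≤ x i ∧ x i ≤ M.bound T i true}

/-- The eight vertices of a cell. -/
def vertex (M : CartesianMesh) (T : M.Cell) (c : Fin 3 → Bool) : E3 :=
  WithLp.toLp 2 fun i => M.bound T i (c i)

/-- The edge of a cell parallel to the `i`-th axis through the vertex `c`. -/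
def edge (M : CartesianMesh) (T : M.Cell) (i : Fin 3) (c : Fin 3 → Bool) : Set E3 :=
  {x ∈ M.cuboid T | ∀ j, j ≠ i → x j = M.bound T j (c j)}

/-- The two faces of a cell orthogonal to the `i`-th axis. -/
def face (M : CartesianMesh) (T : M.Cell) (i : Fin 3) (b : Bool) : Set E3 :=
  {x ∈ M.cuboid T | x i = M.bound T i b}

end CartesianMesh

/-- The outward unit normal of the face orthogonal to the `i`-th axis. -/
noncomputable def faceNormal (i : Fin 3) (b : Bool) : E3 :=
  EuclideanSpace.single i (if b then 1 else -1)

/-! ### Surfaces -/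

/-- `f` is a `C²` function with non-vanishing gradient at `x` whose zero set is `Γ` near `x`. -/
def IsDefiningFunctionAt (Γ : Set E3) (x : E3) (f : E3 → ℝ) : Prop :=
  ContDiffAt ℝ 2 f x ∧ gradient f x ≠ 0 ∧ ∀ᶠ y in 𝓝 x, (y ∈ Γ ↔ f y = 0)

/-- A closed (compact, without boundary) embedded `C²` surface. -/
def IsClosedC2Surface (Γ : Set E3) : Prop :=
  IsCompact Γ ∧ ∀ x ∈ Γ, ∃ f, IsDefiningFunctionAt Γ x f

/-- The segment of length `2 r` centred at `x ∈ Γ` and perpendicular to `Γ`. -/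
def normalSegment (Γ : Set E3) (x : E3) (r : ℝ) : Set E3 :=
  {y | ∃ f, IsDefiningFunctionAt Γ x f ∧ (∃ t : ℝ, y - x = t • gradient f x) ∧ ‖y - x‖ ≤ r}

/-- The reach of `Γ`: the supremum of the radii for which the normal segments at distinct points
are disjoint. -/
noncomputable def surfaceReach (Γ : Set E3) : ℝ≥0∞ :=
  ⨆ (r : ℝ≥0) (_ : ∀ x ∈ Γ, ∀ y ∈ Γ, x ≠ y →
    Disjoint (normalSegment Γ x r) (normalSegment Γ y r)), (r : ℝ≥0∞)

/-- The maximal (absolute) principal curvature of `Γ`, as the supremum of the absolute normal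
curvatures `|D²f(v, v)| / |∇f|` over all points of `Γ` and all unit tangent vectors `v`. -/
noncomputable def maxCurvature (Γ : Set E3) : ℝ≥0∞ :=
  ⨆ (x : E3) (_ : x ∈ Γ) (f : E3 → ℝ) (_ : IsDefiningFunctionAt Γ x f) (v : E3)
    (_ : ‖v‖ = 1 ∧ inner ℝ (gradient f x) v = 0),
    ENNReal.ofReal (|fderiv ℝ (fderiv ℝ f) x v v| / ‖gradient f x‖)

/-! ### Interfaces -/

/-- A closed `C²` surface `Γ ⊆ Ω` that separates `Ω` into two open parts `Ω⁻` and `Ω⁺`. -/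
structure Interface (Ω : Set E3) where
  Γ : Set E3
  Ωminus : Set E3
  Ωplus : Set E3
  surface : IsClosedC2Surface Γ
  subset : Γ ⊆ Ω
  isOpen_minus : IsOpen Ωminus
  isOpen_plus : IsOpen Ωplus
  disjoint : Disjoint Ωminus Ωplus
  union_eq : Ωminus ∪ Ωplus = Ω \ Γ
  subset_closure_minus : Γ ⊆ closure Ωminus
  subset_closure_plus : Γ ⊆ closure Ωplus

namespace Interface

variable {Ω : Set E3}

/-- The `-` side of `Γ` in the closure of `Ω`: the set `Ω⁻` together with the adjacent part of the
boundary of `Ω` (so that elements and faces that touch this boundary are split as well). -/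
def minusSide (I : Interface Ω) : Set E3 := closure I.Ωminus \ I.Γ

/-- The `+` side of `Γ` in the closure of `Ω`. -/
def plusSide (I : Interface Ω) : Set E3 := closure I.Ωplus \ I.Γ

open Classical in
/-- The function that is `a` on the `-` side and `b` on the `+` side. On `Γ`, where a piecewise
function is not defined, it is given the value `0`. -/
noncomputable def piecewise {V : Type*} [Zero V] (I : Interface Ω) (a b : E3 → V) : E3 → V :=
  fun x => if x ∈ I.minusSide then a x else if x ∈ I.plusSide then b x else 0

/-- The piecewise constant coefficient `β`. -/
noncomputable def coeff (I : Interface Ω) (βm βp : ℝ) : E3 → ℝ :=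
  I.piecewise (fun _ => βm) (fun _ => βp)

end Interface

/-- `T` is an interface element: its vertices are not all on the same side of `Γ`. -/
def IsInterfaceElement (M : CartesianMesh) (I : Interface M.domain) (T : M.Cell) : Prop :=
  ¬ (∀ c, M.vertex T c ∈ I.minusSide) ∧ ¬ (∀ c, M.vertex T c ∈ I.plusSide)

/-- The hypotheses under which the mesh resolves the interface. -/
structure Resolves (M : CartesianMesh) (I : Interface M.domain) : Prop where
  /-- `h < r_Γ / (3 √3)`, where `r_Γ` is the reach of `Γ`. -/
  reach : ENNReal.ofReal (3 * √3 * M.h) < surfaceReach I.Γ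
  /-- `h κ ≤ 0.0288`, where `κ` is the maximal principal curvature of `Γ`. -/
  curvature : ENNReal.ofReal M.h * maxCurvature I.Γ ≤ ENNReal.ofReal 0.0288
  /-- `Γ` does not meet an edge at more than one point. -/
  edges : ∀ T i c, (I.Γ ∩ M.edge T i c).Subsingleton
  /-- `Γ` does not meet a face at more than two edges. -/
  faces : ∀ T i b, {e : Set E3 | (∃ j c, j ≠ i ∧ c i = b ∧ e = M.edge T j c) ∧
    (I.Γ ∩ e).Nonempty}.encard ≤ 2

/-! ### Trilinear immersed finite element functions -/

/-- The space `Q₁` of trilinear polynomials, by coefficients: `p S` is the coefficient of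
the monomial `∏ i ∈ S, x i`. -/
abbrev Q1 : Type := Finset (Fin 3) → ℝ

/-- The polynomial function of `p ∈ Q₁`. -/
def Q1.eval (p : Q1) (x : E3) : ℝ := ∑ S : Finset (Fin 3), p S * ∏ i ∈ S, x i

/-- `D 0`, `D 1`, `D 2` are non-collinear points at which `Γ` meets edges of `T`. -/
def IsIntersectionTriangle (M : CartesianMesh) (I : Interface M.domain) (T : M.Cell)
    (D : Fin 3 → E3) : Prop :=
  AffineIndependent ℝ D ∧ ∀ j, D j ∈ I.Γ ∧ ∃ i c, D j ∈ M.edge T i c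

/-- The pair `φm`, `φp` of trilinear polynomials satisfies the approximate jump conditions on the
plane through the triangle `D`, so that it is an immersed finite element function. -/
structure IsIFE (βm βp : ℝ) (D : Fin 3 → E3) (φm φp : Q1) : Prop where
  /-- The polynomials agree on the plane. -/
  plane : ∀ x ∈ affineSpan ℝ (Set.range D), φm.eval x = φp.eval x
  /-- They have the same coefficients of `xy`, `yz`, `xz` and `xyz`. -/
  high : ∀ S : Finset (Fin 3), 2 ≤ S.card → φm S = φp S
  /-- Their fluxes through the plane agree at the centroid of the triangle. -/
  flux : ∀ n : E3, ‖n‖ = 1 → (∀ v ∈ (affineSpan ℝ (Set.range D)).direction, inner ℝ v n = 0) →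
    βm * inner ℝ (gradient φm.eval (Finset.univ.centroid ℝ D)) n =
      βp * inner ℝ (gradient φp.eval (Finset.univ.centroid ℝ D)) n

/-- The piecewise gradient `∇φ_T`. -/
noncomputable def ifeGrad {Ω : Set E3} (I : Interface Ω) (φm φp : Q1) : E3 → E3 :=
  I.piecewise (gradient φm.eval) (gradient φp.eval)

/-! ### Norms -/

/-- The `L²` norm on the cuboid of `T`. -/
noncomputable def l2Elem {V : Type*} [Norm V] (M : CartesianMesh) (T : M.Cell) (g : E3 → V) : ℝ :=
  √(∫ x in M.cuboid T, ‖g x‖ ^ 2)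

/-- The point of the plane of a face with the coordinates `y` in that plane. -/
noncomputable def facePoint (M : CartesianMesh) (T : M.Cell) (i : Fin 3) (b : Bool)
    (y : Fin 2 → ℝ) : E3 :=
  WithLp.toLp 2 (Fin.insertNth (α := fun _ => ℝ) i (M.bound T i b) y)

/-- The `L²` norm on a face of `T`, with respect to two-dimensional Lebesgue measure in the
coordinates of the plane of the face. -/
noncomputable def l2Face (M : CartesianMesh) (T : M.Cell) (i : Fin 3) (b : Bool)
    (g : E3 → ℝ) : ℝ :=
  √(∫ y in facePoint M T i b ⁻¹' M.face T i b, g (facePoint M T i b y) ^ 2)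

/-!
Why the trace inequalities hold: on one side of `Γ` the gradient is controlled on the whole element
by its `L²` norm on that side alone, and the jump conditions carry this control to the other side.

A closed `C²` surface is Lebesgue null (`IsClosedC2Surface.volume_eq_zero`), so one of the two sides
fills at least half of the volume of the element (`Interface.half_volume_le`). A trilinear
polynomial satisfies a Remez inequality: its square at any point of a cuboid is at most a fixed
multiple of its mean square over any measurable part of at least half the volume
(`Q1.sq_eval_mul_volume_le`). This follows from a bound on the volume of sublevel sets of functions
that are affine in each variable separately, obtained by slicing
(`volume_separatelyAffine_sublevel_le`). The partial derivatives of a trilinear polynomial are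
trilinear, so with `K` the resulting bound the gradient on the large side is at most `K` on all of
the element.

The two polynomials of an immersed finite element function differ by an affine function that
vanishes on the plane, hence their gradients differ by a constant normal vector, whose length is
given by the flux condition (`IsIFE.mul_norm_gradient_sub_le`). Let `a` be the coefficient on the
large side and `b` the other one. If `a ≤ b`, the other gradient is at most `2 K`
(`IsIFE.norm_gradient_le_of_le`), which yields the inequality without weights. If `b ≤ a`, then `b`
times the other gradient is at most `a K` (`IsIFE.mul_norm_gradient_le_of_le`), which yields the
inequality with the weight `β`. The choice between the two depends only on the element, the
interface and the coefficients. Integrating these pointwise bounds over a face, of area at most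
`h ^ 2`, and comparing with the volume of the element, at least `(h / σ) ^ 3`, gives the
factor `h ^ (-1 / 2)` (`l2Face_le_l2Elem`). For `β⁻ ≤ β⁺` the same pointwise bounds
show that `β` times the gradient is at most `2 β⁺ K` whichever side is large. On that side
`√β ≥ √β⁻`, which accounts for the factor `β⁺ / √β⁻` of the last inequality.
-/

open MeasureTheory

/-! ### Sublevel sets of separately affine functions -/

/-- An affine function that reaches the size `M` somewhere on an interval is smaller than `ε M` only
on a small part of the interval: the absolute value of the slope is at least `M / (2 (b - a))` as
soon as the sublevel set is nonempty. -/
theorem volume_affine_sublevel_le {f : ℝ → ℝ} (hf : ∃ α β, ∀ t, f t = α * t + β)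
    {a b t₀ M ε : ℝ} (ht₀ : t₀ ∈ Set.Icc a b) (hM : 0 < M) (hfM : M ≤ |f t₀|) (hε : ε ≤ 1 / 2) :
    volume {t | t ∈ Set.Icc a b ∧ |f t| < ε * M} ≤ ENNReal.ofReal (4 * ε * (b - a)) := by
  obtain ⟨α, β, hf⟩ := hf
  refine (Real.volume_le_diam _).trans (Metric.ediam_le fun s hs t ht => ?_)
  rw [edist_dist]
  refine ENNReal.ofReal_le_ofReal ?_
  obtain ⟨hs, hsM⟩ := hs
  obtain ⟨ht, htM⟩ := ht
  have h₁ : |α| * |s - t| ≤ 2 * (ε * M) := by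
    rw [← abs_mul, show α * (s - t) = f s - f t by rw [hf, hf]; ring]
    linarith [abs_sub (f s) (f t)]
  have h₂ : M / 2 ≤ |α| * (b - a) := by
    have h₃ : |f t₀| - |f s| ≤ |α| * |t₀ - s| := by
      rw [← abs_mul, show α * (t₀ - s) = f t₀ - f s by rw [hf, hf]; ring]
      exact abs_sub_abs_le_abs_sub _ _
    have h₄ : |t₀ - s| ≤ b - a := abs_sub_le_of_le_of_le ht₀.1 ht₀.2 hs.1 hs.2
    have h₅ := mul_le_mul_of_nonneg_left h₄ (abs_nonneg α)
    nlinarith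
  have hε0 : 0 < ε := by
    by_contra! h
    nlinarith [abs_nonneg (f s)]
  have hα : 0 < |α| := by
    rcases (abs_nonneg α).eq_or_lt with h | h
    · rw [← h] at h₂; linarith
    · exact h
  rw [Real.dist_eq]
  refine le_of_mul_le_mul_left ?_ hα
  nlinarith

/-- A function that is affine in each variable separately and reaches the size `M` somewhere on a
box is smaller than `ε ^ n M` only on a small part of the box. -/
theorem volume_separatelyAffine_sublevel_le {ε : ℝ} (hε₀ : 0 < ε) (hε : ε ≤ 1 / 2) (n : ℕ) :
    ∀ {f : (Fin n → ℝ) → ℝ}, Continuous f →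
      (∀ x i, ∃ α β, ∀ t, f (Function.update x i t) = α * t + β) →
      ∀ {a b x₀ : Fin n → ℝ}, x₀ ∈ Set.Icc a b → ∀ {M : ℝ}, 0 < M → M ≤ |f x₀| →
        volume {x | x ∈ Set.Icc a b ∧ |f x| < ε ^ n * M} ≤
          ENNReal.ofReal (4 * n * ε * ∏ i, (b i - a i)) := by
  induction n with
  | zero =>
    intro f _ _ a b x₀ _ M _ hfM
    have : {x | x ∈ Set.Icc a b ∧ |f x| < ε ^ 0 * M} = ∅ := by
      ext x
      simp only [Subsingleton.elim x x₀, pow_zero, one_mul, Set.mem_ofPred_eq,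
        Set.mem_empty_iff_false, iff_false, not_and, not_lt]
      exact fun _ => hfM
    rw [this, measure_empty]
    exact zero_le
  | succ n ih =>
    intro f hfc hf a b x₀ hx₀ M hM hfM
    set e := MeasurableEquiv.piFinSuccAbove (fun _ : Fin (n + 1) => ℝ) 0 with he
    have hmp := (volume_preserving_piFinSuccAbove (fun _ : Fin (n + 1) => ℝ) 0)
    have hcons : ∀ q : ℝ × (Fin n → ℝ), e.symm q = Fin.cons q.1 q.2 := fun q => by
      simp [he, MeasurableEquiv.piFinSuccAbove, Fin.insertNthEquiv]
    set g : ℝ × (Fin n → ℝ) → ℝ := fun q => f (Fin.cons q.1 q.2) with hg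
    have hgc : Continuous g := hfc.comp (by fun_prop)
    set y₀ : Fin n → ℝ := Fin.tail x₀ with hy₀
    set a' := Fin.tail a
    set b' := Fin.tail b
    have hmem : ∀ t (y : Fin n → ℝ), (Fin.cons t y : Fin (n + 1) → ℝ) ∈ Set.Icc a b ↔
        t ∈ Set.Icc (a 0) (b 0) ∧ y ∈ Set.Icc a' b' := by
      intro t y
      simp only [Set.mem_Icc, Pi.le_def, Fin.forall_fin_succ, Fin.cons_zero, Fin.cons_succ, a', b',
        Fin.tail]
      tauto
    have hx₀' : x₀ 0 ∈ Set.Icc (a 0) (b 0) ∧ y₀ ∈ Set.Icc a' b' := by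
      rw [← hmem, hy₀, Fin.cons_self_tail]; exact hx₀
    -- A point of the sublevel set either has its first coordinate in `bad`, or lies on a slice on
    -- which the function reaches `ε M`, so that the induction hypothesis applies to the slice.
    set bad : Set ℝ := {t | t ∈ Set.Icc (a 0) (b 0) ∧ |g (t, y₀)| < ε * M} with hbad
    set S : Set (ℝ × (Fin n → ℝ)) := {q | (q.1 ∈ Set.Icc (a 0) (b 0) ∧ ε * M ≤ |g (q.1, y₀)|) ∧
      q.2 ∈ Set.Icc a' b' ∧ |g q| < ε ^ n * (ε * M)} with hS
    have hSm : MeasurableSet S := by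
      refine MeasurableSet.inter (MeasurableSet.inter (measurableSet_Icc.preimage measurable_fst) ?_)
        (MeasurableSet.inter (measurableSet_Icc.preimage measurable_snd) ?_)
      · exact measurableSet_le measurable_const (show Continuous fun q : ℝ × (Fin n → ℝ) =>
          |g (q.1, y₀)| by fun_prop).measurable
      · exact measurableSet_lt (show Continuous fun q : ℝ × (Fin n → ℝ) =>
          |g q| by fun_prop).measurable measurable_const
    have hP : 0 ≤ ∏ i, (b' i - a' i) := Finset.prod_nonneg fun i _ =>
      sub_nonneg.2 ((hx₀'.2.1 i).trans (hx₀'.2.2 i))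
    have hab : 0 ≤ b 0 - a 0 := sub_nonneg.2 (hx₀'.1.1.trans hx₀'.1.2)
    have hbadv : volume bad ≤ ENNReal.ofReal (4 * ε * (b 0 - a 0)) := by
      refine volume_affine_sublevel_le (f := fun t => g (t, y₀)) ?_ hx₀'.1 hM ?_ hε
      · obtain ⟨α, β, h⟩ := hf x₀ 0
        refine ⟨α, β, fun t => ?_⟩
        rw [← h, hg]
        simp only [hy₀]
        rw [← Fin.cons_self_tail x₀, Fin.update_cons_zero, Fin.tail_cons]
      · simpa only [hg, hy₀, Fin.cons_self_tail] using hfM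
    have hslice : ∀ t, volume (Prod.mk t ⁻¹' S) ≤
        (Set.Icc (a 0) (b 0)).indicator
          (fun _ => ENNReal.ofReal (4 * n * ε * ∏ i, (b' i - a' i))) t := by
      intro t
      by_cases ht : t ∈ Set.Icc (a 0) (b 0) ∧ ε * M ≤ |g (t, y₀)|
      · rw [Set.indicator_of_mem ht.1]
        refine (measure_mono ?_).trans (ih (f := fun y => g (t, y)) (by fun_prop) ?_ hx₀'.2
          (mul_pos hε₀ hM) ht.2)
        · exact fun y hy => hy.2
        · intro x i
          obtain ⟨α, β, h⟩ := hf (Fin.cons t x) i.succ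
          refine ⟨α, β, fun s => ?_⟩
          rw [← h, hg]
          simp only [Fin.cons_update]
      · have : Prod.mk t ⁻¹' S = ∅ := by
          ext y
          simp only [Set.mem_preimage, hS, Set.mem_ofPred_eq, Set.mem_empty_iff_false, iff_false]
          exact fun h => ht h.1
        rw [this]; simp
    have hSv : volume S ≤
        ENNReal.ofReal (4 * n * ε * ∏ i, (b' i - a' i)) * ENNReal.ofReal (b 0 - a 0) := by
      rw [Measure.volume_eq_prod, Measure.prod_apply hSm]
      refine (lintegral_mono hslice).trans ?_
      rw [lintegral_indicator measurableSet_Icc, setLIntegral_const, Real.volume_Icc]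
    have hsub : e.symm ⁻¹' {x | x ∈ Set.Icc a b ∧ |f x| < ε ^ (n + 1) * M} ⊆
        bad ×ˢ Set.Icc a' b' ∪ S := by
      rintro q ⟨hq, hq'⟩
      rw [hcons] at hq hq'
      rw [hmem] at hq
      rcases lt_or_ge |g (q.1, y₀)| (ε * M) with h | h
      · exact Or.inl ⟨⟨hq.1, h⟩, hq.2⟩
      · exact Or.inr ⟨⟨hq.1, h⟩, hq.2, by rw [pow_succ, mul_assoc] at hq'; exact hq'⟩
    rw [← (hmp.symm e).measure_preimage_equiv]
    refine (measure_mono hsub).trans ((measure_union_le _ _).trans ?_)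
    have hprod : volume (bad ×ˢ Set.Icc a' b') ≤
        ENNReal.ofReal (4 * ε * (b 0 - a 0)) * ENNReal.ofReal (∏ i, (b' i - a' i)) := by
      rw [Measure.volume_eq_prod, Measure.prod_prod, Real.volume_Icc_pi,
        ENNReal.ofReal_prod_of_nonneg fun i _ => sub_nonneg.2 ((hx₀'.2.1 i).trans (hx₀'.2.2 i))]
      gcongr
    refine (add_le_add hprod hSv).trans ?_
    rw [← ENNReal.ofReal_mul (by positivity), ← ENNReal.ofReal_mul (by positivity),
      ← ENNReal.ofReal_add (by positivity) (by positivity)]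
    refine ENNReal.ofReal_le_ofReal (le_of_eq ?_)
    rw [Fin.prod_univ_succ]
    simp only [a', b', Fin.tail]
    push_cast
    ring

/-! ### Closed surfaces are null sets -/

/-- Near one of its points the surface has at most one point on each line in the direction of the
gradient, so it is disjoint from infinitely many of its bounded translates. -/
theorem IsDefiningFunctionAt.exists_nhds_null {Γ : Set E3} {x : E3} {f : E3 → ℝ} (hΓ : IsClosed Γ)
    (hf : IsDefiningFunctionAt Γ x f) : ∃ r > 0, volume (Γ ∩ Metric.closedBall x r) = 0 := by
  obtain ⟨hf₂, hf₀, hfΓ⟩ := hf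
  set v := gradient f x with hv
  have hd := hf₂.hasStrictFDerivAt (by norm_num)
  have hvpos : 0 < ‖v‖ := norm_pos_iff.2 hf₀
  -- Along `t • v` the linear part is `t ‖v‖ ^ 2`; an error of at most `(‖v‖ / 2) ‖t • v‖`
  -- cannot compensate it.
  have hd' := hd.isLittleO.def (half_pos hvpos)
  have hfv : fderiv ℝ f x v = ‖v‖ ^ 2 := by
    rw [← real_inner_self_eq_norm_sq, hv, gradient, InnerProductSpace.toDual_symm_apply]
  rw [nhds_prod_eq] at hd'
  obtain ⟨s, hs, hsd⟩ := Filter.mem_prod_same_iff.1 hd'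
  obtain ⟨r, hr, hrs⟩ := Metric.nhds_basis_closedBall.mem_iff.1 (Filter.inter_mem hs hfΓ)
  refine ⟨r, hr, ?_⟩
  refine Measure.addHaar_eq_zero_of_disjoint_translates volume
    (u := fun n : ℕ => (1 / ((n : ℝ) + 1)) • v) ?_ ?_
    (hΓ.inter Metric.isClosed_closedBall).measurableSet
  · refine (Metric.isBounded_closedBall (x := (0 : E3)) (r := ‖v‖)).subset ?_
    rintro _ ⟨n, rfl⟩
    rw [mem_closedBall_zero_iff, norm_smul, Real.norm_of_nonneg (by positivity)]
    refine mul_le_of_le_one_left hvpos.le ?_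
    rw [div_le_one (by positivity)]
    linarith [(Nat.cast_nonneg n : (0 : ℝ) ≤ n)]
  · intro m n hmn
    refine Set.disjoint_left.2 ?_
    rintro _ ⟨_, rfl, y, hy, rfl⟩ ⟨_, rfl, z, hz, h⟩
    simp only at h
    set t : ℝ := 1 / ((n : ℝ) + 1) - 1 / ((m : ℝ) + 1) with ht
    have hyz : y - z = t • v := by
      rw [ht, sub_smul, sub_eq_sub_iff_add_eq_add, add_comm, ← h, add_comm]
    have ht₀ : t ≠ 0 := by
      rw [ht, sub_ne_zero]
      intro h
      apply hmn
      rw [one_div, one_div, inv_inj, add_left_inj, Nat.cast_inj] at h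
      exact h.symm
    have hy' := hrs hy.2
    have hz' := hrs hz.2
    have hfy : f y = 0 := hy'.2.1 hy.1
    have hfz : f z = 0 := hz'.2.1 hz.1
    have := hsd (Set.mk_mem_prod hy'.1 hz'.1)
    simp only [Set.mem_ofPred_eq, hfy, hfz, hyz, map_smul, hfv, smul_eq_mul,
      sub_self, zero_sub, norm_neg, norm_mul, norm_pow, norm_norm, norm_smul] at this
    have ht' : 0 < ‖t‖ := norm_pos_iff.2 ht₀
    nlinarith [mul_pos ht' (pow_pos hvpos 2)]

theorem IsClosedC2Surface.volume_eq_zero {Γ : Set E3} (hΓ : IsClosedC2Surface Γ) :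
    volume Γ = 0 := by
  refine measure_null_of_locally_null _ fun x hx => ?_
  obtain ⟨f, hf⟩ := hΓ.2 x hx
  obtain ⟨r, hr, h⟩ := hf.exists_nhds_null hΓ.1.isClosed
  exact ⟨_, inter_mem_nhdsWithin _ (Metric.closedBall_mem_nhds x hr), h⟩

/-! ### Trilinear polynomials -/

namespace Q1

theorem eval_eq (p : Q1) (x : E3) :
    p.eval x = p ∅ + p {0} * x 0 + p {1} * x 1 + p {2} * x 2 + p {0, 1} * (x 0 * x 1) +
      p {0, 2} * (x 0 * x 2) + p {1, 2} * (x 1 * x 2) + p {0, 1, 2} * (x 0 * x 1 * x 2) := by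
  have h : (Finset.univ : Finset (Finset (Fin 3))) =
      {∅, {0}, {1}, {2}, {0, 1}, {0, 2}, {1, 2}, {0, 1, 2}} := by decide
  rw [Q1.eval, h]
  repeat rw [Finset.sum_insert (by decide)]
  rw [Finset.sum_singleton]
  simp only [Finset.prod_empty, Finset.prod_singleton,
    Finset.prod_insert (show (0 : Fin 3) ∉ ({1} : Finset (Fin 3)) by decide),
    Finset.prod_insert (show (0 : Fin 3) ∉ ({2} : Finset (Fin 3)) by decide),
    Finset.prod_insert (show (1 : Fin 3) ∉ ({2} : Finset (Fin 3)) by decide),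
    Finset.prod_insert (show (0 : Fin 3) ∉ ({1, 2} : Finset (Fin 3)) by decide)]
  ring

theorem continuous_eval (p : Q1) : Continuous p.eval := by
  have h : p.eval = fun x => ∑ S : Finset (Fin 3), p S * ∏ i ∈ S, x i := rfl
  rw [h]
  fun_prop

/-- The partial derivative `∂p/∂xᵢ`, which is again trilinear. -/
def partialDeriv (p : Q1) (i : Fin 3) : Q1 := fun S => if i ∈ S then 0 else p (insert i S)

theorem gradient_eval (p : Q1) (x : E3) :
    gradient p.eval x = WithLp.toLp 2 fun i => (p.partialDeriv i).eval x := by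
  refine HasGradientAt.gradient ?_
  rw [hasGradientAt_iff_hasFDerivAt]
  have hx : ∀ i, HasFDerivAt (fun y : E3 => y i) (EuclideanSpace.proj (𝕜 := ℝ) i) x := fun i =>
    (EuclideanSpace.proj (𝕜 := ℝ) i).hasFDerivAt
  have h := (((((((hasFDerivAt_const (p ∅) x).add ((hx 0).const_mul (p {0}))).add
    ((hx 1).const_mul (p {1}))).add ((hx 2).const_mul (p {2}))).add
    (((hx 0).mul (hx 1)).const_mul (p {0, 1}))).add
    (((hx 0).mul (hx 2)).const_mul (p {0, 2}))).add
    (((hx 1).mul (hx 2)).const_mul (p {1, 2}))).add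
    ((((hx 0).mul (hx 1)).mul (hx 2)).const_mul (p {0, 1, 2}))
  refine (h.congr_of_eventuallyEq (Filter.Eventually.of_forall fun y => ?_)).congr_fderiv ?_
  · simp [eval_eq]
  · ext v
    have e₁ : (insert 1 {0} : Finset (Fin 3)) = {0, 1} := by decide
    have e₂ : (insert 2 {0} : Finset (Fin 3)) = {0, 2} := by decide
    have e₃ : (insert 2 {1} : Finset (Fin 3)) = {1, 2} := by decide
    have e₄ : (insert 1 {0, 2} : Finset (Fin 3)) = {0, 1, 2} := by decide
    have e₅ : (insert 2 {0, 1} : Finset (Fin 3)) = {0, 1, 2} := by decide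
    simp [PiLp.inner_apply, Fin.sum_univ_three, eval_eq, partialDeriv, e₁, e₂, e₃, e₄, e₅]
    ring

theorem eval_update_affine (p : Q1) (x : Fin 3 → ℝ) (i : Fin 3) :
    ∃ α β, ∀ t, p.eval (WithLp.toLp 2 (Function.update x i t)) = α * t + β := by
  refine ⟨(p.partialDeriv i).eval (WithLp.toLp 2 x),
    p.eval (WithLp.toLp 2 (Function.update x i 0)), fun t => ?_⟩
  fin_cases i
  · simp [eval_eq, partialDeriv]; ring
  · have e₁ : (insert 1 {0} : Finset (Fin 3)) = {0, 1} := by decide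
    have e₄ : (insert 1 {0, 2} : Finset (Fin 3)) = {0, 1, 2} := by decide
    simp [eval_eq, partialDeriv, e₁, e₄]; ring
  · have e₂ : (insert 2 {0} : Finset (Fin 3)) = {0, 2} := by decide
    have e₃ : (insert 2 {1} : Finset (Fin 3)) = {1, 2} := by decide
    have e₅ : (insert 2 {0, 1} : Finset (Fin 3)) = {0, 1, 2} := by decide
    simp [eval_eq, partialDeriv, e₂, e₃, e₅]; ring

theorem continuous_gradient (p : Q1) : Continuous (gradient p.eval) := by
  have h : gradient p.eval = fun x => WithLp.toLp 2 fun i => (p.partialDeriv i).eval x :=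
    funext p.gradient_eval
  rw [h]
  exact (PiLp.continuous_toLp 2 _).comp (continuous_pi fun i => continuous_eval _)

end Q1

/-! ### The cuboid of a cell -/

namespace CartesianMesh

variable (M : CartesianMesh) (T : M.Cell)

theorem edgeLength_pos (i : Fin 3) : 0 < M.edgeLength T i :=
  sub_pos.2 (M.node_strictMono i Fin.castSucc_lt_succ)

theorem edgeLength_le_h (i : Fin 3) : M.edgeLength T i ≤ M.h :=
  le_ciSup (f := fun q : M.Cell × Fin 3 => M.edgeLength q.1 q.2) (Set.finite_range _).bddAbove
    (T, i)

theorem h_pos (M : CartesianMesh) (T : M.Cell) : 0 < M.h :=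
  (M.edgeLength_pos T 0).trans_le (M.edgeLength_le_h T 0)

theorem cuboid_eq_preimage : M.cuboid T = WithLp.ofLp (p := 2) ⁻¹'
    Set.Icc (fun i => M.bound T i false) (fun i => M.bound T i true) := by
  ext x
  simp only [cuboid, Set.mem_ofPred_eq, Set.mem_preimage, Set.mem_Icc, Pi.le_def]
  exact forall_and

theorem isCompact_cuboid : IsCompact (M.cuboid T) := by
  rw [cuboid_eq_preimage]
  exact (PiLp.homeomorph 2 _).isClosedEmbedding.isCompact_preimage isCompact_Icc

theorem convex_cuboid : Convex ℝ (M.cuboid T) := by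
  rw [cuboid_eq_preimage]
  exact (convex_Icc _ _).linear_preimage (WithLp.linearEquiv 2 ℝ (Fin 3 → ℝ)).toLinearMap

theorem volume_cuboid : volume (M.cuboid T) = ENNReal.ofReal (∏ i, M.edgeLength T i) := by
  rw [cuboid_eq_preimage, (PiLp.volume_preserving_ofLp (Fin 3)).measure_preimage
    measurableSet_Icc.nullMeasurableSet, Real.volume_Icc_pi,
    ENNReal.ofReal_prod_of_nonneg fun i _ => (M.edgeLength_pos T i).le]
  rfl

theorem cuboid_subset_closure_domain : M.cuboid T ⊆ closure M.domain := by
  have h : closure (WithLp.ofLp (p := 2) ⁻¹' Set.univ.pi fun i =>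
      Set.Ioo (M.bound T i false) (M.bound T i true)) = M.cuboid T := by
    rw [show (WithLp.ofLp (p := 2) : E3 → Fin 3 → ℝ) = PiLp.homeomorph 2 _ from rfl,
      ← Homeomorph.preimage_closure, closure_pi_set, cuboid_eq_preimage, ← Set.pi_univ_Icc]
    simp only [closure_Ioo (sub_pos.1 (M.edgeLength_pos T _)).ne]
    rfl
  rw [← h]
  refine closure_mono fun x hx i => ?_
  have hi := hx i (Set.mem_univ i)
  exact ⟨((M.node_strictMono i).monotone (Fin.zero_le _)).trans_lt hi.1,
    hi.2.trans_le ((M.node_strictMono i).monotone (Fin.le_last _))⟩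

end CartesianMesh

/-! ### A Remez inequality on the cuboid of a cell -/

/-- A trilinear polynomial is bounded on the cuboid by its mean square over any measurable part of
at least half the volume. -/
theorem Q1.sq_eval_mul_volume_le (p : Q1) (M : CartesianMesh) (T : M.Cell) {A : Set E3}
    (hAm : MeasurableSet A) (hAT : A ⊆ M.cuboid T)
    (hA : volume.real (M.cuboid T) ≤ 2 * volume.real A) {x₀ : E3} (hx₀ : x₀ ∈ M.cuboid T) :
    p.eval x₀ ^ 2 * volume.real (M.cuboid T) ≤ 4 * 48 ^ 6 * ∫ x in A, p.eval x ^ 2 := by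
  rcases eq_or_ne (p.eval x₀) 0 with h0 | h0
  · rw [h0]
    have : 0 ≤ ∫ x in A, p.eval x ^ 2 := integral_nonneg fun x => sq_nonneg _
    simp only [ne_eq, OfNat.ofNat_ne_zero, not_false_eq_true, zero_pow, zero_mul]
    positivity
  have hpc := p.continuous_eval
  set K := |p.eval x₀| with hK
  have hK0 : 0 < K := abs_pos.2 h0
  set V := volume.real (M.cuboid T) with hV
  have hVe : V = ∏ i, M.edgeLength T i := by
    rw [hV, Measure.real, M.volume_cuboid, ENNReal.toReal_ofReal
      (Finset.prod_nonneg fun i _ => (M.edgeLength_pos T i).le)]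
  -- With `ε = 1 / 48` the sublevel set fills at most `4 * 3 * ε = 1 / 4` of the cuboid, which leaves
  -- at least a quarter of the cuboid in `A`.
  set B : Set E3 := M.cuboid T ∩ {x | |p.eval x| < (1 / 48) ^ 3 * K} with hB
  have hBm : MeasurableSet B :=
    (M.isCompact_cuboid T).measurableSet.inter (measurableSet_lt (by fun_prop) measurable_const)
  have hBv : volume B ≤ ENNReal.ofReal (V / 4) := by
    have hpre : B = WithLp.ofLp ⁻¹' {y : Fin 3 → ℝ |
        y ∈ Set.Icc (fun i => M.bound T i false) (fun i => M.bound T i true) ∧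
        |p.eval (WithLp.toLp 2 y)| < (1 / 48) ^ 3 * K} := by
      rw [hB, M.cuboid_eq_preimage]; rfl
    have hcont : Continuous fun y : Fin 3 → ℝ => p.eval (WithLp.toLp 2 y) :=
      hpc.comp (PiLp.continuous_toLp 2 _)
    rw [hpre, (PiLp.volume_preserving_ofLp (Fin 3)).measure_preimage]
    · rw [M.cuboid_eq_preimage] at hx₀
      refine (volume_separatelyAffine_sublevel_le (by norm_num) (by norm_num) 3 hcont
        p.eval_update_affine hx₀ hK0 le_rfl).trans (ENNReal.ofReal_le_ofReal (le_of_eq ?_))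
      rw [hVe]
      simp only [CartesianMesh.edgeLength]
      push_cast
      ring
    · exact (measurableSet_Icc.inter
        (measurableSet_lt hcont.abs.measurable measurable_const)).nullMeasurableSet
  have hTfin : volume (M.cuboid T) ≠ ⊤ := (M.isCompact_cuboid T).measure_lt_top.ne
  have hAfin : volume A ≠ ⊤ := measure_ne_top_of_subset hAT hTfin
  have hBr : volume.real B ≤ V / 4 := ENNReal.toReal_le_of_le_ofReal (by positivity) hBv
  have hdiff : V / 4 ≤ volume.real (A \ B) := by
    have := le_measureReal_sdiff (μ := volume) (s₁ := A) (s₂ := B)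
      (measure_ne_top_of_subset Set.inter_subset_left hTfin)
    linarith
  have hint : IntegrableOn (fun x => p.eval x ^ 2) A :=
    ((hpc.pow 2).continuousOn.integrableOn_compact (M.isCompact_cuboid T)).mono_set hAT
  have h1 : ((1 / 48) ^ 3 * K) ^ 2 * volume.real (A \ B) ≤ ∫ x in A \ B, p.eval x ^ 2 := by
    refine setIntegral_ge_of_const_le_real (hAm.diff hBm)
      (measure_ne_top_of_subset Set.sdiff_subset hAfin) (fun x hx => ?_)
      (hint.mono_set Set.sdiff_subset)
    have hx' : (1 / 48) ^ 3 * K ≤ |p.eval x| := not_lt.1 fun h => hx.2 ⟨hAT hx.1, h⟩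
    rw [← sq_abs (p.eval x)]
    gcongr
  have h2 : ∫ x in A \ B, p.eval x ^ 2 ≤ ∫ x in A, p.eval x ^ 2 :=
    setIntegral_mono_set hint (Filter.Eventually.of_forall fun x => sq_nonneg _)
      (Filter.Eventually.of_forall (Set.sdiff_subset (s := A) (t := B)))
  have h3 : ((1 / 48) ^ 3 * K) ^ 2 * (V / 4) ≤ ∫ x in A, p.eval x ^ 2 :=
    (mul_le_mul_of_nonneg_left hdiff (by positivity)).trans (h1.trans h2)
  rw [← sq_abs (p.eval x₀), ← hK]
  linarith

theorem Q1.norm_gradient_sq_mul_volume_le (p : Q1) (M : CartesianMesh) (T : M.Cell) {A : Set E3}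
    (hAm : MeasurableSet A) (hAT : A ⊆ M.cuboid T)
    (hA : volume.real (M.cuboid T) ≤ 2 * volume.real A) {x₀ : E3} (hx₀ : x₀ ∈ M.cuboid T) :
    ‖gradient p.eval x₀‖ ^ 2 * volume.real (M.cuboid T) ≤
      4 * 48 ^ 6 * ∫ x in A, ‖gradient p.eval x‖ ^ 2 := by
  have hn : ∀ x, ‖gradient p.eval x‖ ^ 2 = ∑ i, (p.partialDeriv i).eval x ^ 2 := fun x => by
    rw [p.gradient_eval, EuclideanSpace.norm_sq_eq]
    simp
  simp only [hn]
  rw [integral_finsetSum, Finset.mul_sum, Finset.sum_mul]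
  · exact Finset.sum_le_sum fun i _ =>
      (p.partialDeriv i).sq_eval_mul_volume_le M T hAm hAT hA hx₀
  · exact fun i _ => (((p.partialDeriv i).continuous_eval.pow 2).continuousOn.integrableOn_compact
      (M.isCompact_cuboid T)).mono_set hAT

/-! ### The jump of the gradient -/

namespace IsIFE

variable {βm βp : ℝ} {D : Fin 3 → E3} {φm φp : Q1}

theorem symm (h : IsIFE βm βp D φm φp) : IsIFE βp βm D φp φm :=
  ⟨fun x hx => (h.plane x hx).symm, fun S hS => (h.high S hS).symm,
    fun n hn hv => (h.flux n hn hv).symm⟩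

/-- The gradients on the two sides differ by a constant vector normal to the plane, and the flux
condition at the centroid determines its length. -/
theorem mul_norm_gradient_sub_le (h : IsIFE βm βp D φm φp) (x : E3) :
    βp * ‖gradient φp.eval x - gradient φm.eval x‖ ≤
      |βm - βp| * ‖gradient φm.eval (Finset.univ.centroid ℝ D)‖ := by
  set w : E3 := WithLp.toLp 2 fun i => φp {i} - φm {i} with hw
  have h01 := h.high {0, 1} (by decide)
  have h02 := h.high {0, 2} (by decide)
  have h12 := h.high {1, 2} (by decide)
  have h012 := h.high {0, 1, 2} (by decide)
  have hgrad : ∀ y, gradient φp.eval y = gradient φm.eval y + w := by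
    intro y
    have e₁ : (insert 1 {0} : Finset (Fin 3)) = {0, 1} := by decide
    have e₂ : (insert 2 {0} : Finset (Fin 3)) = {0, 2} := by decide
    have e₃ : (insert 2 {1} : Finset (Fin 3)) = {1, 2} := by decide
    have e₄ : (insert 1 {0, 2} : Finset (Fin 3)) = {0, 1, 2} := by decide
    have e₅ : (insert 2 {0, 1} : Finset (Fin 3)) = {0, 1, 2} := by decide
    rw [Q1.gradient_eval, Q1.gradient_eval]
    ext i
    fin_cases i <;>
      · simp [hw, Q1.eval_eq, Q1.partialDeriv, h01, h02, h12, h012, e₁, e₂, e₃, e₄, e₅]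
        ring
  have horth : ∀ v ∈ (affineSpan ℝ (Set.range D)).direction, inner ℝ v w = 0 := by
    intro v hv
    have h0 : D 0 ∈ affineSpan ℝ (Set.range D) := mem_affineSpan ℝ (Set.mem_range_self 0)
    have h1 := h.plane _ h0
    have h2 := h.plane _ (AffineSubspace.vadd_mem_of_mem_direction hv h0)
    rw [Q1.eval_eq, Q1.eval_eq, h01, h02, h12, h012] at h1 h2
    simp only [vadd_eq_add, PiLp.add_apply] at h2
    simp only [PiLp.inner_apply, Fin.sum_univ_three, hw, RCLike.inner_apply, conj_trivial]
    linarith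
  rw [hgrad x, add_sub_cancel_left]
  rcases eq_or_ne w 0 with hw0 | hw0
  · rw [hw0, norm_zero, mul_zero]; positivity
  have hwpos : 0 < ‖w‖ := norm_pos_iff.2 hw0
  set X := Finset.univ.centroid ℝ D
  -- The jump itself, normalized, serves as the unit normal in the flux condition.
  set n : E3 := ‖w‖⁻¹ • w with hn
  have hn1 : ‖n‖ = 1 := norm_smul_inv_norm hw0
  have hflux := h.flux n hn1 fun v hv => by rw [hn, inner_smul_right, horth v hv, mul_zero]
  have hwn : inner ℝ w n = ‖w‖ := by
    rw [hn, inner_smul_right, real_inner_self_eq_norm_sq]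
    field_simp
  rw [hgrad X, inner_add_left, hwn] at hflux
  have hkey : βp * ‖w‖ = (βm - βp) * inner ℝ (gradient φm.eval X) n := by linarith
  have hin : |inner ℝ (gradient φm.eval X) n| ≤ ‖gradient φm.eval X‖ := by
    simpa [hn1] using abs_real_inner_le_norm (gradient φm.eval X) n
  calc βp * ‖w‖ ≤ |βp * ‖w‖| := le_abs_self _
    _ = |βm - βp| * |inner ℝ (gradient φm.eval X) n| := by rw [hkey, abs_mul]
    _ ≤ _ := mul_le_mul_of_nonneg_left hin (abs_nonneg _)

theorem norm_gradient_le_of_le (h : IsIFE βm βp D φm φp) (hβm : 0 < βm)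
    (hle : βm ≤ βp) {s : Set E3} (hX : Finset.univ.centroid ℝ D ∈ s) {K : ℝ}
    (hK : ∀ x ∈ s, ‖gradient φm.eval x‖ ≤ K) {x : E3} (hx : x ∈ s) :
    ‖gradient φp.eval x‖ ≤ 2 * K := by
  have h1 := h.mul_norm_gradient_sub_le x
  rw [abs_of_nonpos (sub_nonpos.2 hle)] at h1
  have hβp := hβm.trans_le hle
  have h2 : ‖gradient φp.eval x - gradient φm.eval x‖ ≤ K := by
    refine le_of_mul_le_mul_left (h1.trans ?_) hβp
    have := norm_nonneg (gradient φm.eval (Finset.univ.centroid ℝ D))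
    nlinarith [hK _ hX]
  linarith [norm_le_norm_add_norm_sub' (gradient φp.eval x) (gradient φm.eval x), hK x hx]

theorem mul_norm_gradient_le_of_le (h : IsIFE βm βp D φm φp) (hβp : 0 < βp)
    (hle : βp ≤ βm) {s : Set E3} (hX : Finset.univ.centroid ℝ D ∈ s) {K : ℝ}
    (hK : ∀ x ∈ s, ‖gradient φm.eval x‖ ≤ K) {x : E3} (hx : x ∈ s) :
    βp * ‖gradient φp.eval x‖ ≤ βm * K := by
  have h1 := h.mul_norm_gradient_sub_le x
  rw [abs_of_nonneg (sub_nonneg.2 hle)] at h1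
  nlinarith [norm_le_norm_add_norm_sub' (gradient φp.eval x) (gradient φm.eval x), hK x hx, hK _ hX]

end IsIFE

theorem IsIntersectionTriangle.centroid_mem {M : CartesianMesh} {I : Interface M.domain}
    {T : M.Cell} {D : Fin 3 → E3} (hD : IsIntersectionTriangle M I T D) :
    Finset.univ.centroid ℝ D ∈ M.cuboid T := by
  rw [Finset.centroid_def, Finset.affineCombination_eq_linear_combination _ _ _
    (Finset.sum_centroidWeights_eq_one_of_nonempty ℝ _ Finset.univ_nonempty)]
  refine (M.convex_cuboid T).sum_mem (fun j _ => ?_)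
    (Finset.sum_centroidWeights_eq_one_of_nonempty ℝ _ Finset.univ_nonempty) fun j _ => ?_
  · simp
  · obtain ⟨i, c, hic⟩ := (hD.2 j).2
    exact hic.1

/-! ### The two sides of the interface -/

namespace Interface

variable {Ω : Set E3} (I : Interface Ω)

theorem measurableSet_minusSide : MeasurableSet I.minusSide :=
  isClosed_closure.measurableSet.diff I.surface.1.isClosed.measurableSet

theorem measurableSet_plusSide : MeasurableSet I.plusSide :=
  isClosed_closure.measurableSet.diff I.surface.1.isClosed.measurableSet

theorem closure_subset : closure Ω ⊆ I.minusSide ∪ I.plusSide ∪ I.Γ := by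
  have h : Ω ⊆ I.Ωminus ∪ I.Ωplus ∪ I.Γ := by
    rw [I.union_eq]
    exact fun x hx => (em (x ∈ I.Γ)).elim Or.inr fun h => Or.inl ⟨hx, h⟩
  intro x hx
  have h' := closure_mono h hx
  rw [closure_union, closure_union, I.surface.1.isClosed.closure_eq] at h'
  by_cases hΓ : x ∈ I.Γ
  · exact Or.inr hΓ
  · rcases h' with (h' | h') | h'
    · exact Or.inl (Or.inl ⟨h', hΓ⟩)
    · exact Or.inl (Or.inr ⟨h', hΓ⟩)
    · exact Or.inr h'

section Piecewise

variable {V : Type*} {a b : E3 → V} {x : E3}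

theorem piecewise_of_mem_minusSide [Zero V] (hx : x ∈ I.minusSide) : I.piecewise a b x = a x :=
  if_pos hx

theorem piecewise_of_mem_plusSide [Zero V] (hx : x ∈ I.plusSide \ I.minusSide) :
    I.piecewise a b x = b x := by
  rw [piecewise, if_neg hx.2, if_pos hx.1]

theorem norm_piecewise_le [NormedAddCommGroup V] {B : ℝ} (hB : 0 ≤ B) (ha : ‖a x‖ ≤ B)
    (hb : ‖b x‖ ≤ B) : ‖I.piecewise a b x‖ ≤ B := by
  unfold piecewise
  split_ifs <;> simpa

/-- On `Γ` the factor is `ρ 0` rather than `0`, but there the gradient has the value `0`. -/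
theorem comp_coeff_smul_ifeGrad {ρ : ℝ → ℝ} (βm βp : ℝ) (φm φp : Q1) (x : E3) :
    ρ (I.coeff βm βp x) • ifeGrad I φm φp x =
      I.piecewise (fun y => ρ βm • gradient φm.eval y) (fun y => ρ βp • gradient φp.eval y) x := by
  unfold ifeGrad coeff piecewise
  split_ifs <;> simp

theorem integrableOn_sq_norm_piecewise {a b : E3 → E3} (ha : Continuous a) (hb : Continuous b)
    {s : Set E3} (hs : IsCompact s) :
    IntegrableOn (fun x => ‖I.piecewise a b x‖ ^ 2) s := by
  classical
  have h : (fun x => ‖I.piecewise a b x‖ ^ 2) = I.minusSide.piecewise (fun x => ‖a x‖ ^ 2)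
      (I.plusSide.piecewise (fun x => ‖b x‖ ^ 2) 0) := by
    funext x
    unfold piecewise Set.piecewise
    split_ifs <;> simp
  rw [h]
  exact Integrable.piecewise I.measurableSet_minusSide
    ((ha.norm.pow 2).continuousOn.integrableOn_compact hs).integrableOn
    (Integrable.piecewise I.measurableSet_plusSide
      ((hb.norm.pow 2).continuousOn.integrableOn_compact hs).integrableOn
      (integrable_zero _ _ _).integrableOn).integrableOn

end Piecewise

/-- One of the two sides fills at least half of the element. The `+` side is taken without the `-`
side, since this is where a piecewise function has the value of its `+` branch. -/
theorem half_volume_le {M : CartesianMesh} (I : Interface M.domain) (T : M.Cell) :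
    volume.real (M.cuboid T) ≤ 2 * volume.real (M.cuboid T ∩ I.minusSide) ∨
    volume.real (M.cuboid T) ≤ 2 * volume.real (M.cuboid T ∩ (I.plusSide \ I.minusSide)) := by
  have hT := (M.isCompact_cuboid T).measure_lt_top (μ := (volume : Measure E3)).ne
  have hsub : M.cuboid T ⊆ (M.cuboid T ∩ I.minusSide) ∪
      (M.cuboid T ∩ (I.plusSide \ I.minusSide)) ∪ I.Γ := by
    intro x hx
    by_cases hm : x ∈ I.minusSide
    · exact Or.inl (Or.inl ⟨hx, hm⟩)
    · rcases I.closure_subset (M.cuboid_subset_closure_domain T hx) with (h | h) | h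
      · exact absurd h hm
      · exact Or.inl (Or.inr ⟨hx, h, hm⟩)
      · exact Or.inr h
  have hΓ : volume.real I.Γ = 0 := by rw [Measure.real, I.surface.volume_eq_zero]; rfl
  have h1 := measureReal_mono (μ := volume) hsub (by
    refine measure_union_ne_top (measure_union_ne_top ?_ ?_) ?_
    · exact measure_ne_top_of_subset Set.inter_subset_left hT
    · exact measure_ne_top_of_subset Set.inter_subset_left hT
    · rw [I.surface.volume_eq_zero]; exact ENNReal.zero_ne_top)
  have h2 := measureReal_union_le (μ := volume) ((M.cuboid T ∩ I.minusSide) ∪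
      (M.cuboid T ∩ (I.plusSide \ I.minusSide))) I.Γ
  have h3 := measureReal_union_le (μ := volume) (M.cuboid T ∩ I.minusSide)
      (M.cuboid T ∩ (I.plusSide \ I.minusSide))
  by_contra! h
  linarith [h.1, h.2]

end Interface

/-! ### From pointwise bounds to norms -/

theorem norm_faceNormal (i : Fin 3) (b : Bool) : ‖faceNormal i b‖ = 1 := by
  cases b <;> simp [faceNormal]

theorem abs_inner_faceNormal_le (v : E3) (i : Fin 3) (b : Bool) :
    |inner ℝ v (faceNormal i b)| ≤ ‖v‖ := by
  simpa [norm_faceNormal] using abs_real_inner_le_norm v (faceNormal i b)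

/-- The function need not be measurable: the integral of a function that is not integrable is `0`. -/
theorem sq_l2Face_le (M : CartesianMesh) (T : M.Cell) (i : Fin 3) (b : Bool) {g : E3 → ℝ} {B : ℝ}
    (hg : ∀ x ∈ M.cuboid T, |g x| ≤ B) : l2Face M T i b g ^ 2 ≤ M.h ^ 2 * B ^ 2 := by
  set S := facePoint M T i b ⁻¹' M.face T i b with hS
  have hSsub : S ⊆ Set.Icc (fun j => M.bound T (i.succAbove j) false)
      (fun j => M.bound T (i.succAbove j) true) := by
    intro y hy
    have hy' : ∀ j, _ := hy.1
    constructor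
    · intro j; simpa [facePoint] using (hy' (i.succAbove j)).1
    · intro j; simpa [facePoint] using (hy' (i.succAbove j)).2
  have hvol : volume S ≤ ENNReal.ofReal (M.h ^ 2) := by
    refine (measure_mono hSsub).trans ?_
    rw [Real.volume_Icc_pi, Fin.prod_univ_two, pow_two, ENNReal.ofReal_mul (M.h_pos T).le]
    gcongr
    · exact M.edgeLength_le_h T _
    · exact M.edgeLength_le_h T _
  have hreal : volume.real S ≤ M.h ^ 2 := ENNReal.toReal_le_of_le_ofReal (sq_nonneg _) hvol
  have hint := norm_setIntegral_le_of_norm_le_const (μ := volume) (s := S)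
    (f := fun y => g (facePoint M T i b y) ^ 2) (C := B ^ 2)
    (hvol.trans_lt ENNReal.ofReal_lt_top) fun y hy => by
      rw [Real.norm_of_nonneg (sq_nonneg _), ← sq_abs]
      have := hg _ hy.1
      gcongr
  rw [l2Face, Real.sq_sqrt (integral_nonneg fun y => sq_nonneg _)]
  calc _ ≤ B ^ 2 * volume.real S := (le_abs_self _).trans hint
    _ ≤ B ^ 2 * M.h ^ 2 := by gcongr
    _ = _ := mul_comm _ _

/-- The constant of the trace inequalities on a mesh whose edges have length at least `h / σ`. -/
noncomputable def traceConstant (σ : ℝ) : ℝ := √(16 * 48 ^ 6 * σ ^ 3)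

theorem traceConstant_pos {σ : ℝ} (hσ : 0 < σ) : 0 < traceConstant σ :=
  Real.sqrt_pos.2 (by positivity)

/-- If `G` is `t` times the gradient of `p` on a part `A` of at least half the volume, and `g` is
bounded on the whole cuboid by `2 r t` times any bound of that gradient, then the face norm of `g`
is controlled by the element norm of `G`. -/
theorem l2Face_le_l2Elem {σ : ℝ} (hσ : 0 < σ) {M : CartesianMesh} {T : M.Cell}
    (hreg : ∀ i, M.h / σ ≤ M.edgeLength T i) {A : Set E3} (hAm : MeasurableSet A)
    (hAT : A ⊆ M.cuboid T) (hA : volume.real (M.cuboid T) ≤ 2 * volume.real A) (p : Q1)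
    {g : E3 → ℝ} {G : E3 → E3} (hG : IntegrableOn (fun x => ‖G x‖ ^ 2) (M.cuboid T)) {r t : ℝ}
    (hr : 0 ≤ r) (hGA : ∀ x ∈ A, ‖G x‖ = t * ‖gradient p.eval x‖)
    (hg : ∀ K, 0 ≤ K → (∀ x ∈ M.cuboid T, ‖gradient p.eval x‖ ≤ K) →
      ∀ x ∈ M.cuboid T, |g x| ≤ 2 * (r * t * K)) (i : Fin 3) (b : Bool) :
    l2Face M T i b g ≤
      traceConstant σ * M.h ^ (-(1 / 2) : ℝ) * r * l2Elem M T G := by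
  have hh := M.h_pos T
  set V := volume.real (M.cuboid T) with hV
  have hVe : V = ∏ i, M.edgeLength T i := by
    rw [hV, Measure.real, M.volume_cuboid, ENNReal.toReal_ofReal
      (Finset.prod_nonneg fun i _ => (M.edgeLength_pos T i).le)]
  have hVh : (M.h / σ) ^ 3 ≤ V := by
    rw [hVe]
    simpa only [Finset.prod_const, Finset.card_univ, Fintype.card_fin] using
      Finset.prod_le_prod (s := Finset.univ) (f := fun _ : Fin 3 => M.h / σ)
      (fun _ _ => by positivity) (fun i _ => hreg i)
  have hVpos : 0 < V := lt_of_lt_of_le (by positivity) hVh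
  set J := ∫ x in A, ‖gradient p.eval x‖ ^ 2 with hJ
  have hJ0 : 0 ≤ J := integral_nonneg fun x => sq_nonneg _
  set K := √(4 * 48 ^ 6 * J / V) with hK
  have hKsq : K ^ 2 * V = 4 * 48 ^ 6 * J := by
    rw [hK, Real.sq_sqrt (by positivity)]
    field_simp
  have hpK : ∀ x ∈ M.cuboid T, ‖gradient p.eval x‖ ≤ K := fun x hx => by
    refine Real.le_sqrt_of_sq_le ?_
    rw [le_div_iff₀ hVpos]
    exact p.norm_gradient_sq_mul_volume_le M T hAm hAT hA hx
  have hface := sq_l2Face_le M T i b (hg K (Real.sqrt_nonneg _) hpK)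
  have hElem : t ^ 2 * J ≤ l2Elem M T G ^ 2 := by
    rw [l2Elem, Real.sq_sqrt (integral_nonneg fun x => sq_nonneg _), hJ, ← integral_const_mul]
    calc ∫ x in A, t ^ 2 * ‖gradient p.eval x‖ ^ 2 = ∫ x in A, ‖G x‖ ^ 2 :=
          setIntegral_congr_fun hAm fun x hx => by simp only [hGA x hx, mul_pow]
      _ ≤ _ := setIntegral_mono_set hG (Filter.Eventually.of_forall fun x => sq_nonneg _)
          (Filter.Eventually.of_forall hAT)
  have hhalf : (M.h ^ (-(1 / 2) : ℝ)) ^ 2 = M.h⁻¹ := by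
    rw [← Real.rpow_natCast, ← Real.rpow_mul hh.le, ← Real.rpow_neg_one]
    norm_num
  have hl : 0 ≤ l2Elem M T G := Real.sqrt_nonneg _
  have hC := traceConstant_pos hσ
  refine abs_le_of_sq_le_sq' ?_ (by positivity) |>.2
  rw [traceConstant, mul_pow, mul_pow, mul_pow, Real.sq_sqrt (by positivity), hhalf]
  have hKV : K ^ 2 ≤ 4 * 48 ^ 6 * J * (σ / M.h) ^ 3 := by
    have h1 : K ^ 2 * (M.h / σ) ^ 3 ≤ 4 * 48 ^ 6 * J := by
      rw [← hKsq]; gcongr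
    have h2 : (M.h / σ) ^ 3 * (σ / M.h) ^ 3 = 1 := by
      rw [← mul_pow]; field_simp
    calc K ^ 2 = K ^ 2 * (M.h / σ) ^ 3 * (σ / M.h) ^ 3 := by rw [mul_assoc, h2, mul_one]
      _ ≤ _ := by gcongr
  calc l2Face M T i b g ^ 2 ≤ M.h ^ 2 * (2 * (r * t * K)) ^ 2 := hface
    _ = 4 * M.h ^ 2 * r ^ 2 * t ^ 2 * K ^ 2 := by ring
    _ ≤ 4 * M.h ^ 2 * r ^ 2 * t ^ 2 * (4 * 48 ^ 6 * J * (σ / M.h) ^ 3) := by gcongr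
    _ = 16 * 48 ^ 6 * σ ^ 3 * M.h⁻¹ * r ^ 2 * (t ^ 2 * J) := by field_simp; ring
    _ ≤ _ := by gcongr

/-- The trace inequality with the weight `ρ (β)` on the face, the weight `τ (β)` on the element and
the extra factor `r`, under a pointwise bound of both weighted gradients by any bound of the
gradient of the side that fills at least half of the element. -/
theorem ifeGrad_trace_le {σ : ℝ} (hσ : 0 < σ) {M : CartesianMesh} {I : Interface M.domain}
    {T : M.Cell} (hreg : ∀ i, M.h / σ ≤ M.edgeLength T i) {βm βp : ℝ} {φm φp : Q1}
    {ρ τ : ℝ → ℝ} (hρm : 0 ≤ ρ βm) (hρp : 0 ≤ ρ βp) (hτm : 0 ≤ τ βm) (hτp : 0 ≤ τ βp)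
    {r : ℝ} (hr : 0 ≤ r)
    (hfat : (volume.real (M.cuboid T) ≤ 2 * volume.real (M.cuboid T ∩ I.minusSide) ∧
        ∀ K, 0 ≤ K → (∀ x ∈ M.cuboid T, ‖gradient φm.eval x‖ ≤ K) → ∀ x ∈ M.cuboid T,
          ρ βm * ‖gradient φm.eval x‖ ≤ 2 * (r * τ βm * K) ∧
          ρ βp * ‖gradient φp.eval x‖ ≤ 2 * (r * τ βm * K)) ∨
      (volume.real (M.cuboid T) ≤
          2 * volume.real (M.cuboid T ∩ (I.plusSide \ I.minusSide)) ∧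
        ∀ K, 0 ≤ K → (∀ x ∈ M.cuboid T, ‖gradient φp.eval x‖ ≤ K) → ∀ x ∈ M.cuboid T,
          ρ βm * ‖gradient φm.eval x‖ ≤ 2 * (r * τ βp * K) ∧
          ρ βp * ‖gradient φp.eval x‖ ≤ 2 * (r * τ βp * K)))
    (i : Fin 3) (b : Bool) :
    l2Face M T i b (fun x => ρ (I.coeff βm βp x) * inner ℝ (ifeGrad I φm φp x) (faceNormal i b)) ≤
      traceConstant σ * M.h ^ (-(1 / 2) : ℝ) * r *
        l2Elem M T (fun x => τ (I.coeff βm βp x) • ifeGrad I φm φp x) := by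
  have hg : ∀ x, |ρ (I.coeff βm βp x) * inner ℝ (ifeGrad I φm φp x) (faceNormal i b)| ≤
      ‖I.piecewise (fun y => ρ βm • gradient φm.eval y) (fun y => ρ βp • gradient φp.eval y) x‖ :=
    fun x => by
      rw [← real_inner_smul_left, I.comp_coeff_smul_ifeGrad]
      exact abs_inner_faceNormal_le _ i b
  have hG : IntegrableOn (fun x => ‖τ (I.coeff βm βp x) • ifeGrad I φm φp x‖ ^ 2)
      (M.cuboid T) := by
    simp only [I.comp_coeff_smul_ifeGrad]
    have ha : Continuous fun y => τ βm • gradient φm.eval y :=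
      φm.continuous_gradient.const_smul (τ βm)
    have hb : Continuous fun y => τ βp • gradient φp.eval y :=
      φp.continuous_gradient.const_smul (τ βp)
    exact I.integrableOn_sq_norm_piecewise ha hb (M.isCompact_cuboid T)
  have hT := (M.isCompact_cuboid T).measurableSet
  rcases hfat with ⟨hA, hb⟩ | ⟨hA, hb⟩
  · refine l2Face_le_l2Elem hσ hreg (hT.inter I.measurableSet_minusSide) Set.inter_subset_left hA
      φm (G := fun x => τ (I.coeff βm βp x) • ifeGrad I φm φp x)
      (g := fun x => ρ (I.coeff βm βp x) * inner ℝ (ifeGrad I φm φp x) (faceNormal i b)) hG hr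
      (t := τ βm) (fun x hx => ?_) (fun K hK0 hK x hx => (hg x).trans ?_) i b
    · rw [I.comp_coeff_smul_ifeGrad, I.piecewise_of_mem_minusSide hx.2, norm_smul,
        Real.norm_of_nonneg hτm]
    · refine I.norm_piecewise_le (by positivity) ?_ ?_
      · rw [norm_smul, Real.norm_of_nonneg hρm]; exact (hb K hK0 hK x hx).1
      · rw [norm_smul, Real.norm_of_nonneg hρp]; exact (hb K hK0 hK x hx).2
  · refine l2Face_le_l2Elem hσ hreg
      (hT.inter (I.measurableSet_plusSide.diff I.measurableSet_minusSide)) Set.inter_subset_left hA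
      φp (G := fun x => τ (I.coeff βm βp x) • ifeGrad I φm φp x)
      (g := fun x => ρ (I.coeff βm βp x) * inner ℝ (ifeGrad I φm φp x) (faceNormal i b)) hG hr
      (t := τ βp) (fun x hx => ?_) (fun K hK0 hK x hx => (hg x).trans ?_) i b
    · rw [I.comp_coeff_smul_ifeGrad, I.piecewise_of_mem_plusSide hx.2, norm_smul,
        Real.norm_of_nonneg hτp]
    · refine I.norm_piecewise_le (by positivity) ?_ ?_
      · rw [norm_smul, Real.norm_of_nonneg hρm]; exact (hb K hK0 hK x hx).1
      · rw [norm_smul, Real.norm_of_nonneg hρp]; exact (hb K hK0 hK x hx).2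

/-! ### The trace inequalities -/

theorem theorem4p5 :
    ∀ σ : ℝ, 0 < σ → ∃ C : ℝ, 0 < C ∧
      ∀ (M : CartesianMesh) (I : Interface M.domain), Resolves M I →
      ∀ βm βp : ℝ, 0 < βm → 0 < βp →
      ∀ T : M.Cell, IsInterfaceElement M I T → (∀ i, M.h / σ ≤ M.edgeLength T i) →
      ∀ D : Fin 3 → E3, IsIntersectionTriangle M I T D →
        ((∀ (i : Fin 3) (b : Bool) (φm φp : Q1), IsIFE βm βp D φm φp →
            l2Face M T i b (fun x => inner ℝ (ifeGrad I φm φp x) (faceNormal i b)) ≤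
              C * M.h ^ (-(1 / 2) : ℝ) * l2Elem M T (ifeGrad I φm φp)) ∨
          (∀ (i : Fin 3) (b : Bool) (φm φp : Q1), IsIFE βm βp D φm φp →
            l2Face M T i b
                (fun x => I.coeff βm βp x * inner ℝ (ifeGrad I φm φp x) (faceNormal i b)) ≤
              C * M.h ^ (-(1 / 2) : ℝ) *
                l2Elem M T (fun x => I.coeff βm βp x • ifeGrad I φm φp x))) ∧
        (βm ≤ βp →
          ∀ (i : Fin 3) (b : Bool) (φm φp : Q1), IsIFE βm βp D φm φp →
            l2Face M T i b
                (fun x => I.coeff βm βp x * inner ℝ (ifeGrad I φm φp x) (faceNormal i b)) ≤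
              C * M.h ^ (-(1 / 2) : ℝ) * (βp / √βm) *
                l2Elem M T (fun x => √(I.coeff βm βp x) • ifeGrad I φm φp x)) := by
  intro σ hσ
  refine ⟨traceConstant σ, traceConstant_pos hσ, ?_⟩
  intro M I _ βm βp hβm hβp T _ hreg D hD
  have hX := hD.centroid_mem
  refine ⟨?_, fun hle i b φm φp hφ => ?_⟩
  -- The inequality without weights is used when the large side has the smaller coefficient, the one
  -- with the weight `β` otherwise.
  · have unweighted : ∀ {i b φm φp}, _ := fun {i b φm φp} hfat => ifeGrad_trace_le hσ (I := I)
      (βm := βm) (βp := βp) (φm := φm) (φp := φp) hreg (ρ := fun _ => 1) (τ := fun _ => 1)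
      zero_le_one zero_le_one zero_le_one zero_le_one (r := 1) zero_le_one hfat i b
    have weighted : ∀ {i b φm φp}, _ := fun {i b φm φp} hfat => ifeGrad_trace_le hσ (I := I)
      (βm := βm) (βp := βp) (φm := φm) (φp := φp) hreg (ρ := id) (τ := id)
      hβm.le hβp.le hβm.le hβp.le (r := 1) zero_le_one hfat i b
    simp only [one_mul, one_smul, mul_one, id_eq] at unweighted weighted
    rcases I.half_volume_le T with hA | hA <;> rcases le_total βm βp with hle | hle
    · refine Or.inl fun i b φm φp hφ => unweighted (Or.inl ⟨hA, fun K hK0 hK x hx => ⟨?_, ?_⟩⟩)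
      · linarith [hK x hx]
      · exact hφ.norm_gradient_le_of_le hβm hle hX hK hx
    · refine Or.inr fun i b φm φp hφ => weighted (Or.inl ⟨hA, fun K hK0 hK x hx => ⟨?_, ?_⟩⟩)
      · nlinarith [hK x hx]
      · nlinarith [hφ.mul_norm_gradient_le_of_le hβp hle hX hK hx]
    · refine Or.inr fun i b φm φp hφ => weighted (Or.inr ⟨hA, fun K hK0 hK x hx => ⟨?_, ?_⟩⟩)
      · nlinarith [hφ.symm.mul_norm_gradient_le_of_le hβm hle hX hK hx]
      · nlinarith [hK x hx]
    · refine Or.inl fun i b φm φp hφ => unweighted (Or.inr ⟨hA, fun K hK0 hK x hx => ⟨?_, ?_⟩⟩)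
      · exact hφ.symm.norm_gradient_le_of_le hβp hle hX hK hx
      · linarith [hK x hx]
  · refine ifeGrad_trace_le hσ (ρ := fun y => y) (τ := fun y => √y) hreg hβm.le hβp.le
      (Real.sqrt_nonneg _) (Real.sqrt_nonneg _) (r := βp / √βm) (by positivity) ?_ i b
    have hm : βp / √βm * √βm = βp := div_mul_cancel₀ _ (Real.sqrt_pos.2 hβm).ne'
    -- If the `+` side is the large one, the weight `√βp` on the element leaves a factor
    -- `√βp / √βm ≥ 1` to spare.
    have hp : βp ≤ βp / √βm * √βp := by
      calc βp = βp / √βm * √βm := hm.symm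
        _ ≤ _ := by gcongr
    refine (I.half_volume_le T).imp (fun hA => ⟨hA, fun K hK0 hK x hx => ?_⟩)
      (fun hA => ⟨hA, fun K hK0 hK x hx => ?_⟩)
    · rw [hm]
      constructor
      · nlinarith [hK x hx, mul_le_mul hle (hK x hx) (norm_nonneg _) hβp.le]
      · nlinarith [hφ.norm_gradient_le_of_le hβm hle hX hK hx]
    · have h2 : βp * K ≤ βp / √βm * √βp * K := by gcongr
      have h3 := mul_nonneg hβp.le hK0
      constructor
      · linarith [hφ.symm.mul_norm_gradient_le_of_le hβm hle hX hK hx]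
      · linarith [mul_le_mul_of_nonneg_left (hK x hx) hβp.le]
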